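/- Let $d\in\mathbb N$ and let $\Omega=\mathbb T^d=\mathbb R^d/\mathbb Z^d$ be the flat torus. Let $\phi,\psi\in C^1(\Omega)$ with $\phi<\psi$ in $\Omega$. For $\varepsilon>0$ and $p\in\mathbb R^d$ set $|p|_\varepsilon=\sqrt{\varepsilon^2+|p|^2}$, and for $v:\Omega\to\mathbb R$ set \[ V_\varepsilon(v)=\frac1\varepsilon(\phi-v)_+^4+\frac1\varepsilon(v-\psi)_+^4 , \qquad E_\varepsilon(v)=\int_\Omega |\nabla v|_\varepsilon+V_\varepsilon(v)\,dx \quad (v\in C^1(\Omega)), \] and let, for $v\in W^{1,\infty}(\Omega)$, $E(v)=\int_\Omega|\nabla v|\,dx$ if $\phi\le v\le\psi$ everywhere in $\Omega$, and $E(v)=+\infty$ otherwise. Let $u_\varepsilon\in C^1(\Omega)$ for $\varepsilon\in(0,1)$, and let $u\in W^{1,\infty}(\Omega)$. Assume: (A1) $\sup_{\varepsilon\in(0,1),\,x\in\Omega}\{|u_\varepsilon(x)|,|\nabla u_\varepsilon(x)|\}<\infty$; (A2) $u_\varepsilon\to u$ uniformly in $\Omega$ as $\varepsilon\to0$, and $\phi\le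 u\le\psi$ in $\Omega$; (A3) $\nabla u_\varepsilon\rightharpoonup\nabla u$ weakly-$*$ in $L^\infty(\Omega;\mathbb R^d)$ as $\varepsilon\to0$; (A4) $\sup_{\varepsilon\in(0,1)}\int_\Omega|-H_\varepsilon+f_\varepsilon|\,dx<\infty$, where $H_\varepsilon=-\operatorname{div}\bigl(\nabla u_\varepsilon/|\nabla u_\varepsilon|_\varepsilon\bigr)$ (in the weak sense, as a function in $L^1(\Omega)$) and $f_\varepsilon=-V_\varepsilon'(u_\varepsilon)=\frac4\varepsilon(\phi-u_\varepsilon)_+^3-\frac4\varepsilon(u_\varepsilon-\psi)_+^3$. If $\lim_{\varepsilon\to0}E_\varepsilon(u_\varepsilon)=E(u)$, then \[ \lim_{\varepsilon\to0}\int_\Omega V_\varepsilon(u_\varepsilon)\,dx=0 . \] -/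

import Mathlib

open MeasureTheory Filter Topology
open scoped ContDiff

noncomputable section

namespace ObstacleMCF

/-- `ℝ^d` with its Euclidean norm. Functions on the flat torus `𝕋^d = ℝ^d / ℤ^d` are
represented by `ℤ^d`-periodic functions on this space. -/
abbrev Eucl (d : ℕ) : Type := EuclideanSpace ℝ (Fin d)

/-- `ℤ^d`-periodicity. -/
def IsPeriodic {d : ℕ} {F : Type*} (f : Eucl d → F) : Prop :=
  ∀ (x : Eucl d) (i : Fin d), f (x + EuclideanSpace.single i (1 : ℝ)) = f x

/-- The fundamental cell `[0,1)^d`; integrals over the torus are integrals over it. -/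
def cell (d : ℕ) : Set (Eucl d) := {x | ∀ i, x i ∈ Set.Ico (0 : ℝ) 1}

/-- `u ∈ C^1(𝕋^d)`. -/
def IsC1 {d : ℕ} (u : Eucl d → ℝ) : Prop := IsPeriodic u ∧ ContDiff ℝ 1 u

/-- Smooth test functions on the torus. -/
def IsTest {d : ℕ} (ζ : Eucl d → ℝ) : Prop := IsPeriodic ζ ∧ ContDiff ℝ ∞ ζ

/-- `w ∈ L^∞(𝕋^d; F)` (as a function, not an equivalence class). -/
def IsLInfty {d : ℕ} {F : Type*} [NormedAddCommGroup F] (w : Eucl d → F) : Prop :=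
  IsPeriodic w ∧ AEStronglyMeasurable w (volume.restrict (cell d)) ∧
    ∃ C : ℝ, ∀ᵐ x ∂(volume.restrict (cell d)), ‖w x‖ ≤ C

/-- `G ∈ L^∞(𝕋^d; ℝ^d)` is the weak gradient of `u` on the torus. -/
def IsWeakGrad {d : ℕ} (u : Eucl d → ℝ) (G : Eucl d → Eucl d) : Prop :=
  IsLInfty G ∧
    ∀ ζ : Eucl d → ℝ, IsTest ζ →
      ∫ x in cell d, u x • gradient ζ x = -∫ x in cell d, ζ x • G x

/-- `u ∈ W^{1,∞}(𝕋^d)`. -/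
def IsW1Infty {d : ℕ} (u : Eucl d → ℝ) : Prop :=
  IsLInfty u ∧ ∃ G : Eucl d → Eucl d, IsWeakGrad u G

open Classical in
/-- A representative of the (a.e. unique) weak gradient of `u ∈ W^{1,∞}(𝕋^d)`. -/
def weakGrad {d : ℕ} (u : Eucl d → ℝ) : Eucl d → Eucl d :=
  if h : ∃ G : Eucl d → Eucl d, IsWeakGrad u G then h.choose else 0

/-- `h ∈ L^1(𝕋^d)` is the weak divergence of the vector field `X` on the torus. -/
def IsWeakDiv {d : ℕ} (X : Eucl d → Eucl d) (h : Eucl d → ℝ) : Prop :=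
  IsPeriodic h ∧ IntegrableOn h (cell d) ∧
    ∀ ζ : Eucl d → ℝ, IsTest ζ →
      ∫ x in cell d, h x * ζ x = -∫ x in cell d, inner ℝ (X x) (gradient ζ x)

/-- Weak-* convergence in `L^∞(𝕋^d; ℝ^d)` as `ε → 0⁺`, i.e. against all
test fields in `L^1(𝕋^d; ℝ^d)`. -/
def WeakStarTendsto {d : ℕ} (w : ℝ → Eucl d → Eucl d) (w₀ : Eucl d → Eucl d) : Prop :=
  ∀ η : Eucl d → Eucl d, IntegrableOn η (cell d) →
    Tendsto (fun ε => ∫ x in cell d, inner ℝ (w ε x) (η x)) (𝓝[>] 0)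
      (𝓝 (∫ x in cell d, inner ℝ (w₀ x) (η x)))

/-- `|p|_ε = √(ε² + |p|²)`. -/
def epsNorm {d : ℕ} (ε : ℝ) (p : Eucl d) : ℝ := Real.sqrt (ε ^ 2 + ‖p‖ ^ 2)

/-- The penalization `s ↦ (a - s)₊⁴ / ε + (s - b)₊⁴ / ε` at obstacle values `a`, `b`. -/
def potential (ε a b s : ℝ) : ℝ :=
  1 / ε * (max (a - s) 0) ^ 4 + 1 / ε * (max (s - b) 0) ^ 4

/-- The forcing term `f_ε = - V_ε'(u)`, the derivative being with respect to the value of `u`. -/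
def force {d : ℕ} (φ ψ : Eucl d → ℝ) (ε : ℝ) (u : Eucl d → ℝ) (x : Eucl d) : ℝ :=
  -deriv (potential ε (φ x) (ψ x)) (u x)

/-- The potential energy `∫_Ω V_ε(u) dx`. -/
def potentialEnergy {d : ℕ} (φ ψ : Eucl d → ℝ) (ε : ℝ) (u : Eucl d → ℝ) : ℝ :=
  ∫ x in cell d, potential ε (φ x) (ψ x) (u x)

/-- The energy `E_ε(u) = ∫_Ω √(ε² + |∇u|²) + V_ε(u) dx` of `u ∈ C^1(𝕋^d)`. -/
def energyEps {d : ℕ} (φ ψ : Eucl d → ℝ) (ε : ℝ) (u : Eucl d → ℝ) : ℝ :=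
  ∫ x in cell d, (epsNorm ε (gradient u x) + potential ε (φ x) (ψ x) (u x))

open Classical in
/-- The limit energy of `u ∈ W^{1,∞}(𝕋^d)`: `∫_Ω |∇u| dx` if `φ ≤ u ≤ ψ` everywhere,
and `+∞` otherwise. -/
def energy {d : ℕ} (φ ψ : Eucl d → ℝ) (u : Eucl d → ℝ) : EReal :=
  if {x | ψ x < u x ∨ u x < φ x} = ∅ then
    ((∫ x in cell d, ‖weakGrad u x‖ : ℝ) : EReal)
  else ⊤

/-- The regularized normal `ν_ε = -∇u / |∇u|_ε`. -/
def normalEps {d : ℕ} (ε : ℝ) (u : Eucl d → ℝ) (x : Eucl d) : Eucl d :=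
  -((epsNorm ε (gradient u x))⁻¹ • gradient u x)

end ObstacleMCF

end

namespace ObstacleMCF

/-! The argument is lower semicontinuity by duality. Let η = ∇u/|∇u|, with η = 0 where ∇u = 0. Since
|η| ≤ 1, ∫ ∇u_ε·η ≤ ∫ |∇u_ε|_ε = E_ε(u_ε) - ∫ V_ε(u_ε) (`integral_inner_gradient_le`,
`energyEps_eq_add`). Hence 0 ≤ ∫ V_ε(u_ε) ≤ E_ε(u_ε) - ∫ ∇u_ε·η. Both terms on the right tend to ∫
|∇u|: the first by convergence of energies, the second by weak-* convergence and
`inner_normalize_self`. -/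

lemma cell_subset_closedBall (d : ℕ) : cell d ⊆ Metric.closedBall 0 (Real.sqrt d) := by
  intro x hx
  rw [mem_closedBall_zero_iff, EuclideanSpace.norm_eq]
  refine Real.sqrt_le_sqrt ?_
  calc ∑ i, ‖x i‖ ^ 2 ≤ ∑ _i : Fin d, (1 : ℝ) := by
        refine Finset.sum_le_sum fun i _ => ?_
        have h := hx i
        rw [Real.norm_eq_abs, abs_of_nonneg h.1]
        exact pow_le_one₀ h.1 h.2.le
    _ = d := by simp

lemma volume_cell_lt_top (d : ℕ) : volume (cell d) < ⊤ :=
  (measure_mono (cell_subset_closedBall d)).trans_lt measure_closedBall_lt_top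

/-- The half-open cell need not be compact, so integrability is inherited from a closed ball
containing it. -/
lemma integrableOn_cell_of_continuous {d : ℕ} {f : Eucl d → ℝ} (hf : Continuous f) :
    IntegrableOn f (cell d) :=
  (hf.continuousOn.integrableOn_compact (isCompact_closedBall _ _)).mono_set
    (cell_subset_closedBall d)

lemma continuous_epsNorm_gradient {d : ℕ} {v : Eucl d → ℝ} (hv : ContDiff ℝ 1 v) (ε : ℝ) :
    Continuous fun x => epsNorm ε (gradient v x) := by
  have hg : Continuous (gradient v) :=
    (InnerProductSpace.toDual ℝ (Eucl d)).symm.continuous.comp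
      (hv.continuous_fderiv one_ne_zero)
  unfold epsNorm
  fun_prop

lemma continuous_potential {d : ℕ} {φ ψ v : Eucl d → ℝ} (hφ : Continuous φ) (hψ : Continuous ψ)
    (hv : Continuous v) (ε : ℝ) : Continuous fun x => potential ε (φ x) (ψ x) (v x) := by
  unfold potential
  fun_prop

lemma potential_nonneg {ε : ℝ} (hε : 0 ≤ ε) (a b s : ℝ) : 0 ≤ potential ε a b s := by
  unfold potential
  positivity

lemma norm_le_epsNorm {d : ℕ} (ε : ℝ) (p : Eucl d) : ‖p‖ ≤ epsNorm ε p :=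
  Real.le_sqrt_of_sq_le (by nlinarith [sq_nonneg ε])

lemma IsW1Infty.isWeakGrad_weakGrad {d : ℕ} {v : Eucl d → ℝ} (hv : IsW1Infty v) :
    IsWeakGrad v (weakGrad v) := by
  unfold weakGrad
  rw [dif_pos hv.2]
  exact hv.2.choose_spec

lemma energyEps_eq_add {d : ℕ} {φ ψ v : Eucl d → ℝ} (hφ : Continuous φ) (hψ : Continuous ψ)
    (hv : ContDiff ℝ 1 v) (ε : ℝ) :
    energyEps φ ψ ε v =
      (∫ x in cell d, epsNorm ε (gradient v x)) + potentialEnergy φ ψ ε v :=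
  integral_add (integrableOn_cell_of_continuous (continuous_epsNorm_gradient hv ε))
    (integrableOn_cell_of_continuous (continuous_potential hφ hψ hv.continuous ε))

lemma norm_normalize_le_one {E : Type*} [NormedAddCommGroup E] [NormedSpace ℝ E] (p : E) :
    ‖‖p‖⁻¹ • p‖ ≤ 1 := by
  rw [norm_smul, norm_inv, norm_norm]
  exact inv_mul_le_one

lemma inner_normalize_self {E : Type*} [NormedAddCommGroup E] [InnerProductSpace ℝ E] (p : E) :
    inner ℝ p (‖p‖⁻¹ • p) = ‖p‖ := by
  rw [inner_smul_right, real_inner_self_eq_norm_sq]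
  -- At `p = 0` both sides vanish, by the convention `0⁻¹ = 0`.
  rcases eq_or_ne ‖p‖ 0 with h | h
  · simp [h]
  · field_simp

/-- Makes η an admissible `L^1` test field for the weak-* convergence: it is bounded on a set of
finite measure. -/
lemma integrableOn_normalize {d : ℕ} {G : Eucl d → Eucl d}
    (hG : AEStronglyMeasurable G (volume.restrict (cell d))) :
    IntegrableOn (fun x => ‖G x‖⁻¹ • G x) (cell d) := by
  have hm : AEStronglyMeasurable (fun x => ‖G x‖⁻¹ • G x) (volume.restrict (cell d)) :=
    (hG.aemeasurable.norm.inv.smul hG.aemeasurable).aestronglyMeasurable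
  exact IntegrableOn.of_bound (volume_cell_lt_top d) hm 1
    (Eventually.of_forall fun x => norm_normalize_le_one (G x))

/-- Testing a `C^1` gradient against a field of norm at most one bounds its regularized
total variation from below. -/
lemma integral_inner_gradient_le {d : ℕ} {v : Eucl d → ℝ} (hv : ContDiff ℝ 1 v) (ε : ℝ)
    {η : Eucl d → Eucl d} (hη : ∀ x, ‖η x‖ ≤ 1) :
    ∫ x in cell d, inner ℝ (gradient v x) (η x) ≤
      ∫ x in cell d, epsNorm ε (gradient v x) := by
  refine (Real.le_norm_self _).trans (norm_integral_le_of_norm_le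
    (integrableOn_cell_of_continuous (continuous_epsNorm_gradient hv ε))
    (Eventually.of_forall fun x => ?_))
  calc ‖inner ℝ (gradient v x) (η x)‖ ≤ ‖gradient v x‖ * ‖η x‖ := norm_inner_le_norm _ _
    _ ≤ ‖gradient v x‖ := mul_le_of_le_one_right (norm_nonneg _) (hη x)
    _ ≤ epsNorm ε (gradient v x) := norm_le_epsNorm ε _

end ObstacleMCF

open ObstacleMCF in
theorem mainTheorem12 (d : ℕ) (φ ψ : Eucl d → ℝ) (hφ : IsC1 φ) (hψ : IsC1 ψ)
    (hφψ : ∀ x, φ x < ψ x)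
    (u : ℝ → Eucl d → ℝ) (u₀ : Eucl d → ℝ)
    (hu : ∀ ε ∈ Set.Ioo (0 : ℝ) 1, IsC1 (u ε)) (hu₀ : IsW1Infty u₀)
    -- uniform bounds on `u_ε` and `∇u_ε`
    (hA1 : ∃ C : ℝ, ∀ ε ∈ Set.Ioo (0 : ℝ) 1, ∀ x, |u ε x| ≤ C ∧ ‖gradient (u ε) x‖ ≤ C)
    -- uniform convergence, and the constraint for the limit
    (hA2 : TendstoUniformly u u₀ (𝓝[>] 0) ∧ ∀ x, φ x ≤ u₀ x ∧ u₀ x ≤ ψ x)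
    -- weak-* convergence of the gradients
    (hA3 : WeakStarTendsto (fun ε => gradient (u ε)) (weakGrad u₀))
    -- uniform `L^1` bound on `-H_ε + f_ε`, where `H_ε = div ν_ε`
    (hA4 : ∃ (H : ℝ → Eucl d → ℝ) (C : ℝ), ∀ ε ∈ Set.Ioo (0 : ℝ) 1,
      IsWeakDiv (normalEps ε (u ε)) (H ε) ∧
        ∫ x in cell d, |-(H ε x) + force φ ψ ε (u ε) x| ≤ C)
    (hE : Tendsto (fun ε => (energyEps φ ψ ε (u ε) : EReal)) (𝓝[>] 0) (𝓝 (energy φ ψ u₀))) :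
    Tendsto (fun ε => potentialEnergy φ ψ ε (u ε)) (𝓝[>] 0) (𝓝 0) := by
  have hEeq : energy φ ψ u₀ = ((∫ x in cell d, ‖weakGrad u₀ x‖ : ℝ) : EReal) := by
    -- The obstacle constraint on the limit rules out the value `⊤`, so the energies converge as
    -- real numbers.
    refine if_pos (Set.eq_empty_iff_forall_notMem.2 fun x hx => ?_)
    rcases hx with hx | hx
    · exact hx.not_ge (hA2.2 x).2
    · exact hx.not_ge (hA2.2 x).1
  rw [hEeq, EReal.tendsto_coe] at hE
  have hweak := hA3 _ (integrableOn_normalize hu₀.isWeakGrad_weakGrad.1.2.1)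
  simp only [inner_normalize_self] at hweak
  -- This difference is the upper barrier for the potential energy.
  have hgap := hE.sub hweak
  rw [sub_self] at hgap
  have hev : ∀ᶠ ε in 𝓝[>] (0 : ℝ), ε ∈ Set.Ioo (0 : ℝ) 1 := Ioo_mem_nhdsGT one_pos
  refine tendsto_of_tendsto_of_tendsto_of_le_of_le' tendsto_const_nhds hgap ?_ ?_
  · filter_upwards [hev] with ε hε
    exact integral_nonneg fun x => potential_nonneg hε.1.le _ _ _
  · filter_upwards [hev] with ε hε
    have hC1 := (hu ε hε).2
    rw [energyEps_eq_add hφ.2.continuous hψ.2.continuous hC1]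
    linarith [integral_inner_gradient_le hC1 ε
      fun x => norm_normalize_le_one (weakGrad u₀ x)]
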